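/- Words are maps from finite subsets of $\mathbb Z$ to a finite alphabet. A set of words is regular if a finite automaton recognises it, reading the symbols in the order of their positions, with a filling symbol $\#$ at the positions outside the domain of the word; the place between the positions $-1$ and $0$ is visible to the automaton. The convolution of several words is the word on the union of their domains whose symbol at position $k$ is the tuple of their symbols at $k$ (with $\#$ where a word is undefined). A relation on words is automatic if the set of convolutions of its tuples is regular. A semiautomatic grid is a subring $G$ (with $1$) of $\mathbb R$ that is dense in $\mathbb R$, together with a regular set $A$ of words and a map from $A$ onto $G$ (an element may have several representatives) such that the relations $x+y=z$, $x=y$ and $x<y$ on the values of words of $A$ are automatic and, for every fixed $a\in G$, the relation $a\cdot x=z$ is automatic. A point of $G\times G$ is represented by the convolutions of representatives of its coordinates. A collection $\mathcal L$ of subsets of $G\times G$ is an automatic family if $\mathcal L=\{L_d : d\in E\}$ for some regular set $E$ of words over a finite alphabet such that the set of all convolutions of $d$ and $x$, with $d\in E$ and $x$ a representative of a point of $L_d$, is regular. **Statement.** For no semiautomatic grid $G$ is the family of all lines in $G\times G$, that is, of all sets $\ell\cap(G\times G)$ where $\ell$ is the straight line through two distinct points of $G\times G$, an automatic family. More generally,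 for no semiautomatic grid is there an automatic family that consists of sets $\ell\cap(G\times G)$ with $\ell$ a straight line in $\mathbb R^2$ and that contains all lines $\{(x,y)\in G\times G : y=mx+c\}$ with $m,c\in G$. Moreover, for no semiautomatic grid is the full multiplication, that is, the relation $x\cdot y=z$, automatic. -/

import Mathlib

namespace AutomaticGrid

/-- A word over the alphabet `α`: a map from a finite subset of `ℤ` to `α`.
`w.symb k` is the symbol at position `k`, and `none` is the filling symbol `#`,
which stands at every position outside the domain of the word. -/
@[ext]
structure Word (α : Type*) where
  symb : ℤ → Option α
  finite_dom : {k : ℤ | symb k ≠ none}.Finite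

namespace Word

/-- What an automaton reads when it scans `w` from position `-m` to position `n - 1`.
The letter `Sum.inr ()` is the point between the positions `-1` and `0`; the other letters
are the symbols of `w`, with `Sum.inl none` for the filling symbol `#`. -/
def scan {α : Type*} (w : Word α) (m n : ℕ) : List (Option α ⊕ Unit) :=
  (List.range m).map (fun i : ℕ => Sum.inl (w.symb ((i : ℤ) - (m : ℤ)))) ++
    Sum.inr () :: (List.range n).map (fun i : ℕ => Sum.inl (w.symb (i : ℤ)))

/-- The window `{-m, …, n - 1}` contains the domain of `w`. -/
def Fits {α : Type*} (w : Word α) (m n : ℕ) : Prop :=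
  ∀ k : ℤ, w.symb k ≠ none → -(m : ℤ) ≤ k ∧ k < (n : ℤ)

end Word

/-- A set of words is regular if a finite automaton recognises it, where the automaton scans
the word over an arbitrary window that contains the domain of the word. -/
def IsRegularSet {α : Type*} (S : Set (Word α)) : Prop :=
  Language.IsRegular
    ({l | ∃ w ∈ S, ∃ m n : ℕ, w.Fits m n ∧ l = w.scan m n} : Language (Option α ⊕ Unit))

open Classical in
/-- The convolution of `h` words over the same alphabet, defined on the union of the domains. -/
noncomputable def conv {α : Type*} {h : ℕ} (w : Fin h → Word α) : Word (Fin h → Option α) where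
  symb k := if ∀ i, (w i).symb k = none then none else some (fun i => (w i).symb k)
  finite_dom := by
    refine (Set.finite_iUnion (fun i => (w i).finite_dom)).subset ?_
    intro k hk
    by_contra hn
    refine hk (if_pos fun i => ?_)
    by_contra hi
    exact hn (Set.mem_iUnion.2 ⟨i, hi⟩)

open Classical in
/-- The convolution of two words whose alphabets may differ. -/
noncomputable def conv₂ {α β : Type*} (v : Word α) (w : Word β) :
    Word (Option α × Option β) where
  symb k := if v.symb k = none ∧ w.symb k = none then none else some (v.symb k, w.symb k)
  finite_dom := by
    refine (v.finite_dom.union w.finite_dom).subset ?_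
    intro k hk
    by_contra hn
    refine hk (if_pos ⟨?_, ?_⟩)
    · by_contra hv
      exact hn (Or.inl hv)
    · by_contra hw
      exact hn (Or.inr hw)

/-- An `h`-ary relation on words is automatic if the set of the convolutions of its tuples
is regular. -/
def IsAutomaticRel {α : Type*} {h : ℕ} (R : Set (Fin h → Word α)) : Prop :=
  IsRegularSet (conv '' R)

/-- `{L d : d ∈ E}` is an automatic family: the index set `E` and the set of all convolutions
of `(d, x)` with `d ∈ E` and `x ∈ L d` are regular. -/
def IsAutomaticFamily {δ γ : Type*} (E : Set (Word δ)) (L : Word δ → Set (Word γ)) : Prop :=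
  IsRegularSet E ∧ IsRegularSet {w | ∃ d ∈ E, ∃ x ∈ L d, w = conv₂ d x}

/-- A semiautomatic grid over the alphabet `α`: a semiautomatic ring `(A, +, =, <; ·)` that is
a dense subring `G` of the reals. The word `x ∈ A` represents the real number `val x`; an
element of `G` may have several representatives (the values of `val` outside `A` are never
used). Addition, equality and order are automatic; for every fixed
factor `a`, the functions `x ↦ a · x` and `x ↦ x · a` are automatic. -/
structure SemiautomaticGrid (α : Type*) where
  A : Set (Word α)
  val : Word α → ℝ
  G : Subring ℝ
  regular_A : IsRegularSet A
  image_val : val '' A = (G : Set ℝ)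
  dense : ∀ p r : ℝ, p < r → ∃ q ∈ G, p < q ∧ q < r
  automatic_add :
    IsAutomaticRel {x : Fin 3 → Word α | (∀ i, x i ∈ A) ∧ val (x 0) + val (x 1) = val (x 2)}
  automatic_eq :
    IsAutomaticRel {x : Fin 2 → Word α | (∀ i, x i ∈ A) ∧ val (x 0) = val (x 1)}
  automatic_lt :
    IsAutomaticRel {x : Fin 2 → Word α | (∀ i, x i ∈ A) ∧ val (x 0) < val (x 1)}
  semiautomatic_mul_left : ∀ a ∈ A,
    IsAutomaticRel {x : Fin 2 → Word α | (∀ i, x i ∈ A) ∧ val a * val (x 0) = val (x 1)}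
  semiautomatic_mul_right : ∀ a ∈ A,
    IsAutomaticRel {x : Fin 2 → Word α | (∀ i, x i ∈ A) ∧ val (x 0) * val a = val (x 1)}

namespace SemiautomaticGrid

variable {α : Type*} (𝒢 : SemiautomaticGrid α)

/-- The graph of the full multiplication of the grid, as a ternary relation on words. -/
def mulRel : Set (Fin 3 → Word α) :=
  {x | (∀ i, x i ∈ 𝒢.A) ∧ 𝒢.val (x 0) * 𝒢.val (x 1) = 𝒢.val (x 2)}

/-- The set of grid points `G × G`, as a subset of the real plane. -/
def plane : Set (ℝ × ℝ) := {p | p.1 ∈ 𝒢.G ∧ p.2 ∈ 𝒢.G}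

/-- The words that represent points of `P`: the point `(val x, val y)` is represented by the
convolution of `x` and `y`. -/
def rep (P : Set (ℝ × ℝ)) : Set (Word (Option α × Option α)) :=
  {w | ∃ x ∈ 𝒢.A, ∃ y ∈ 𝒢.A, (𝒢.val x, 𝒢.val y) ∈ P ∧ w = conv₂ x y}

/-- The collection `𝓛` of sets of grid points is an automatic family: it can be indexed, as
`{L d : d ∈ E}`, by a set `E` of words over a finite alphabet in such a way that the sets of
words representing the sets `L d` form an automatic family. -/
def FormsAutomaticFamily (𝓛 : Set (Set (ℝ × ℝ))) : Prop :=
  ∃ (δ : Type) (_ : Finite δ) (E : Set (Word δ)) (L : Word δ → Set (ℝ × ℝ)),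
    L '' E = 𝓛 ∧ IsAutomaticFamily E (fun d => 𝒢.rep (L d))

/-- All lines in `G × G`: the sets of all grid points that lie on the straight line through
two distinct grid points. -/
def lines : Set (Set (ℝ × ℝ)) :=
  {L | ∃ p ∈ 𝒢.plane, ∃ q ∈ 𝒢.plane, p ≠ q ∧
    L = 𝒢.plane ∩ (affineSpan ℝ {p, q} : Set (ℝ × ℝ))}

/-- The sets of grid points cut out of `G × G` by arbitrary straight lines of the real plane. -/
def realLines : Set (Set (ℝ × ℝ)) :=
  {L | ∃ p q : ℝ × ℝ, p ≠ q ∧ L = 𝒢.plane ∩ (affineSpan ℝ {p, q} : Set (ℝ × ℝ))}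

/-- The lines in `G × G` with an equation `y = m x + c` whose coefficients are in `G`. -/
def slopeLines : Set (Set (ℝ × ℝ)) :=
  {L | ∃ m ∈ 𝒢.G, ∃ c ∈ 𝒢.G, L = {p | p ∈ 𝒢.plane ∧ p.2 = m * p.1 + c}}

end SemiautomaticGrid

end AutomaticGrid

/-! Measure a grid element by the least `n` such that it has a representative in the window `[-n,
n)`. Automatic operations enlarge sizes by at most a constant, by pumping: outside the window of the
inputs, positions of a longer output word can be deleted without changing the state that the
automaton reaches (`exists_pumping`). So sums have size `n + c`. If products had size `n + d`, then
writing `N = X * (N / X) + N % X` with `X = 2 ^ 2 ^ i` would give, by induction, all `N ≤ 2 ^ 2 ^ i`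
a size linear in `i`; but only exponentially many words fit a window of given size
(`not_forall_mul_mem_short`). This excludes automatic multiplication.

An automatic family of lines bounds products in the same way (`exists_mul_mem_short_of_lines`). Take
an index `e` of the line `y = x * t`, of any length. It is accepted with `(0, 0)` and with `(1, x)`.
Pumping both convolutions by one common deletion leaves the two short points unchanged and gives a
single short index of a line through both; two points determine a line, so this is the same line. A
second pumping, with the short index and `y` kept fixed, shortens the second coordinate of `(y, x *
y)`. -/

namespace AutomaticGrid

/-! ### Scans of words -/

namespace Word

variable {α β : Type*}

/-- The negative positions of a window, in the order in which they are scanned. -/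
def negPositions (m : ℕ) : List ℤ := (List.range m).map fun i : ℕ => (i : ℤ) - (m : ℤ)

/-- The nonnegative positions of a window, in the order in which they are scanned. -/
def nonnegPositions (n : ℕ) : List ℤ := (List.range n).map fun i : ℕ => (i : ℤ)

/-- The letter that an automaton reads at a position of a word. -/
def letter (w : Word α) (k : ℤ) : Option α ⊕ Unit := Sum.inl (w.symb k)

theorem scan_eq (w : Word α) (m n : ℕ) :
    w.scan m n =
      (negPositions m).map w.letter ++ Sum.inr () :: (nonnegPositions n).map w.letter := by
  simp [scan, negPositions, nonnegPositions, letter, Function.comp_def]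

theorem Fits.mono {w : Word α} {m n m' n' : ℕ} (h : w.Fits m n) (hm : m ≤ m') (hn : n ≤ n') :
    w.Fits m' n' := by
  intro k hk
  have := h k hk
  omega

theorem exists_fits (w : Word α) : ∃ n : ℕ, w.Fits n n := by
  obtain ⟨a, ha⟩ := w.finite_dom.bddAbove
  obtain ⟨b, hb⟩ := w.finite_dom.bddBelow
  refine ⟨a.natAbs + b.natAbs + 1, fun k hk => ?_⟩
  have h1 : k ≤ a := ha hk
  have h2 : b ≤ k := hb hk
  omega

theorem Fits.symb_eq_none {w : Word α} {m n : ℕ} (h : w.Fits m n) {k : ℤ}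
    (hk : ¬ (-(m : ℤ) ≤ k ∧ k < n)) : w.symb k = none := by
  by_contra hne
  exact hk (h k hne)

/-- The origin marker occurs once in a scan, so it fixes the window and hence the position of every
letter. Acceptance of a scan of `v` therefore puts `v` itself into the set. -/
theorem eq_of_scan_eq {v w : Word α} {m n m' n' : ℕ} (hv : v.Fits m n) (hw : w.Fits m' n')
    (h : v.scan m n = w.scan m' n') : v = w := by
  rw [scan_eq, scan_eq] at h
  have hnot : ∀ (u : Word α) (l : List ℤ), (Sum.inr () : Option α ⊕ Unit) ∉ l.map u.letter := by
    intro u l hl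
    simp [letter] at hl
  have hsplit : (negPositions m).map v.letter = (negPositions m').map w.letter ∧
      (nonnegPositions n).map v.letter = (nonnegPositions n').map w.letter := by
    rw [List.append_eq_append_iff] at h
    rcases h with ⟨l, h1, h2⟩ | ⟨l, h1, h2⟩
    · cases l with
      | nil => simp_all
      | cons x l =>
        simp only [List.cons_append, List.cons.injEq] at h2
        exact absurd (h1 ▸ by simp [← h2.1]) (hnot w (negPositions m'))
    · cases l with
      | nil => simp_all
      | cons x l =>
        simp only [List.cons_append, List.cons.injEq] at h2
        exact absurd (h1 ▸ by simp [← h2.1]) (hnot v (negPositions m))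
  obtain ⟨h1, h2⟩ := hsplit
  have hm : m = m' := by simpa [negPositions] using congrArg List.length h1
  have hn : n = n' := by simpa [nonnegPositions] using congrArg List.length h2
  subst hm hn
  ext1
  funext k
  rw [List.map_inj_left] at h1 h2
  by_cases hk : -(m : ℤ) ≤ k ∧ k < n
  · rcases lt_or_ge k 0 with h0 | h0
    · have := h1 k (by
        simp only [negPositions, List.mem_map, List.mem_range]
        exact ⟨(k + m).toNat, by omega, by omega⟩)
      simpa [letter] using this
    · have := h2 k (by
        simp only [nonnegPositions, List.mem_map, List.mem_range]
        exact ⟨k.toNat, by omega, by omega⟩)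
      simpa [letter] using this
  · rw [hv.symb_eq_none hk, hw.symb_eq_none hk]

end Word

/-! ### Simultaneous pumping -/

open Word

/-- A longer input repeats a state, and the loop between the two visits can be cut out; repeat until
the input is short. -/
theorem _root_.DFA.exists_short {ι σ : Type*} [Fintype σ] (M : DFA ι σ) (s : σ) (l : List ι) :
    ∃ l' : List ι, l' ⊆ l ∧ l'.length ≤ Fintype.card σ ∧ M.evalFrom s l' = M.evalFrom s l := by
  induction hn : l.length using Nat.strong_induction_on generalizing l with
  | _ n ih =>
    rcases le_total l.length (Fintype.card σ) with h | h
    · exact ⟨l, List.Subset.refl l, h, rfl⟩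
    · obtain ⟨q, a, b, c, rfl, -, hb, h1, h2, h3⟩ := M.evalFrom_split h rfl
      have hlen : 0 < b.length := List.length_pos_iff.2 hb
      obtain ⟨l', h4, h5, h6⟩ := ih (a ++ c).length (by simp at hn ⊢; omega) (a ++ c) rfl
      refine ⟨l', fun x hx => ?_, h5, ?_⟩
      · have := h4 hx
        simp at this ⊢
        tauto
      · rw [h6, ← h3, DFA.evalFrom_of_append, h1]

/-- Two automata run in parallel, where each letter is translated for each of them. -/
def _root_.DFA.parallel {ι γ₁ γ₂ : Type*} {σ₁ σ₂ : Type*} (M₁ : DFA γ₁ σ₁) (M₂ : DFA γ₂ σ₂)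
    (g₁ : ι → γ₁) (g₂ : ι → γ₂) : DFA ι (σ₁ × σ₂) :=
  { step := fun s x => (M₁.step s.1 (g₁ x), M₂.step s.2 (g₂ x))
    start := (M₁.start, M₂.start)
    accept := M₁.accept ×ˢ M₂.accept }

theorem _root_.DFA.evalFrom_parallel {ι γ₁ γ₂ σ₁ σ₂ : Type*} (M₁ : DFA γ₁ σ₁) (M₂ : DFA γ₂ σ₂)
    (g₁ : ι → γ₁) (g₂ : ι → γ₂) (s : σ₁ × σ₂) (l : List ι) :
    (DFA.parallel M₁ M₂ g₁ g₂).evalFrom s l =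
      (M₁.evalFrom s.1 (l.map g₁), M₂.evalFrom s.2 (l.map g₂)) := by
  induction l generalizing s with
  | nil => rfl
  | cons x l ih =>
    simp only [DFA.evalFrom_cons, List.map_cons, ih]
    rfl

/-- A map of positions that fixes the window `[-n, n)` and lists `l₁` to the left of the window
and `l₂` to the right of it. -/
theorem exists_position_map (n r : ℕ) (l₁ l₂ : List ℤ) (h₁ : ∀ k ∈ l₁, k < -(n : ℤ))
    (h₂ : ∀ k ∈ l₂, (n : ℤ) ≤ k) :
    ∃ f : ℤ → ℤ,
      (∀ k, -(n : ℤ) ≤ k ∧ k < n → f k = k) ∧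
      (∀ k, ¬ (-(n : ℤ) ≤ k ∧ k < n) → ¬ (-(n : ℤ) ≤ f k ∧ f k < n)) ∧
      (∀ k, ¬ (-((l₁.length + n : ℕ) : ℤ) ≤ k ∧ k < ((n + l₂.length : ℕ) : ℤ)) →
        ¬ (-((n + r : ℕ) : ℤ) ≤ f k ∧ f k < ((n + r : ℕ) : ℤ))) ∧
      (negPositions (l₁.length + n)).map f = l₁ ++ negPositions n ∧
      (nonnegPositions (n + l₂.length)).map f = nonnegPositions n ++ l₂ := by
  -- The default values `n + r` and `-(n + r + 1)` lie just outside `[-(n + r), n + r)`, where the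
  -- words to be shortened are blank.
  set f : ℤ → ℤ := fun k =>
    if -(n : ℤ) ≤ k ∧ k < n then k
    else if (n : ℤ) ≤ k then (l₂[(k - n).toNat]?).getD (n + r)
    else if k < -((l₁.length + n : ℕ) : ℤ) then -((n + r + 1 : ℕ) : ℤ)
    else (l₁[(k + (l₁.length + n : ℕ)).toNat]?).getD (-((n + r + 1 : ℕ) : ℤ)) with hf
  have hin : ∀ k, -(n : ℤ) ≤ k ∧ k < n → f k = k := fun k hk => if_pos hk
  have hright : ∀ k, (n : ℤ) ≤ k → f k = (l₂[(k - n).toNat]?).getD (n + r) := by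
    intro k hk
    simp only [hf]
    rw [if_neg (by omega), if_pos hk]
  have hfar : ∀ k, k < -((l₁.length + n : ℕ) : ℤ) → f k = -((n + r + 1 : ℕ) : ℤ) := by
    intro k hk
    simp only [hf]
    rw [if_neg (by omega), if_neg (by omega), if_pos hk]
  have hleft : ∀ k, -((l₁.length + n : ℕ) : ℤ) ≤ k → k < -(n : ℤ) →
      f k = (l₁[(k + (l₁.length + n : ℕ)).toNat]?).getD (-((n + r + 1 : ℕ) : ℤ)) := by
    intro k hk hk'
    simp only [hf]
    rw [if_neg (by omega), if_neg (by omega), if_neg (by omega)]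
  refine ⟨f, hin, ?_, ?_, ?_, ?_⟩
  · intro k hk
    rcases le_or_gt (n : ℤ) k with h | h
    · rw [hright k h]
      rcases hl : l₂[(k - n).toNat]? with _ | x
      · simp only [Option.getD_none]
        omega
      · have := h₂ x (List.mem_of_getElem? hl)
        simp only [Option.getD_some]
        omega
    · rcases lt_or_ge k (-((l₁.length + n : ℕ) : ℤ)) with h' | h'
      · rw [hfar k h']
        omega
      · rw [hleft k h' (by omega)]
        rcases hl : l₁[(k + (l₁.length + n : ℕ)).toNat]? with _ | x
        · simp only [Option.getD_none]
          omega
        · have := h₁ x (List.mem_of_getElem? hl)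
          simp only [Option.getD_some]
          omega
  · intro k hk
    rcases lt_or_ge k (-((l₁.length + n : ℕ) : ℤ)) with h' | h'
    · rw [hfar k h']
      omega
    · rw [hright k (by omega), List.getElem?_eq_none (by omega)]
      simp only [Option.getD_none]
      omega
  · apply List.ext_getElem
    · simp [negPositions]
    · intro i hi hi'
      simp only [negPositions, List.length_append, List.length_map, List.length_range] at hi hi'
      simp only [List.getElem_append, negPositions, List.getElem_map, List.getElem_range]
      split_ifs with h
      · rw [hleft _ (by omega) (by omega)]
        have : ((i : ℤ) - ((l₁.length + n : ℕ) : ℤ) + ((l₁.length + n : ℕ) : ℤ)).toNat = i := by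
          omega
        simp [h]
      · rw [hin _ (by omega)]
        omega
  · apply List.ext_getElem
    · simp [nonnegPositions]
    · intro i hi hi'
      simp only [nonnegPositions, List.length_append, List.length_map, List.length_range] at hi hi'
      simp only [List.getElem_append, nonnegPositions, List.getElem_map, List.getElem_range,
        List.length_map, List.length_range]
      split_ifs with h
      · rw [hin _ (by omega)]
      · rw [hright _ (by omega)]
        have : ((i : ℤ) - (n : ℤ)).toNat = i - n := by omega
        rw [this, List.getElem?_eq_getElem (by omega)]
        simp

/-- If `f` deletes positions outside a window in such a way that an automaton for `S` reaches the
same states, then `S` is closed under this deletion. -/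
theorem exists_mem_of_evalFrom_eq {γ σ : Type*} {S : Set (Word γ)} {M : DFA (Option γ ⊕ Unit) σ}
    (hM : M.accepts = {l | ∃ w ∈ S, ∃ m n : ℕ, w.Fits m n ∧ l = w.scan m n})
    {u : Word γ} (hu : u ∈ S) {n r : ℕ} (hfit : u.Fits (n + r) (n + r))
    {k₁ k₂ l₁ l₂ : List ℤ} {f : ℤ → ℤ}
    (hk₁ : negPositions (n + r) = k₁ ++ negPositions n)
    (hk₂ : nonnegPositions (n + r) = nonnegPositions n ++ k₂)
    (hf : ∀ k, ¬ (-((l₁.length + n : ℕ) : ℤ) ≤ k ∧ k < ((n + l₂.length : ℕ) : ℤ)) →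
        ¬ (-((n + r : ℕ) : ℤ) ≤ f k ∧ f k < ((n + r : ℕ) : ℤ)))
    (hf₁ : (negPositions (l₁.length + n)).map f = l₁ ++ negPositions n)
    (hf₂ : (nonnegPositions (n + l₂.length)).map f = nonnegPositions n ++ l₂)
    (he₁ : M.evalFrom M.start (l₁.map u.letter) = M.evalFrom M.start (k₁.map u.letter))
    (he₂ : M.evalFrom (M.evalFrom M.start ((k₁ ++ negPositions n).map u.letter ++
        Sum.inr () :: (nonnegPositions n).map u.letter)) (l₂.map u.letter) =
      M.evalFrom (M.evalFrom M.start ((k₁ ++ negPositions n).map u.letter ++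
        Sum.inr () :: (nonnegPositions n).map u.letter)) (k₂.map u.letter)) :
    ∃ v ∈ S, v.Fits (l₁.length + n) (n + l₂.length) ∧ ∀ k, v.symb k = u.symb (f k) := by
  have hout : ∀ k, ¬ (-((l₁.length + n : ℕ) : ℤ) ≤ k ∧ k < ((n + l₂.length : ℕ) : ℤ)) →
      u.symb (f k) = none := fun k hk => hfit.symb_eq_none (hf k hk)
  set v : Word γ := ⟨fun k => u.symb (f k), by
    refine (Set.finite_Ico (-((l₁.length + n : ℕ) : ℤ)) ((n + l₂.length : ℕ) : ℤ)).subset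
      fun k hk => ?_
    by_contra hn
    exact hk (hout k hn)⟩ with hv
  have hvfit : v.Fits (l₁.length + n) (n + l₂.length) := by
    intro k hk
    by_contra hn
    exact hk (hout k hn)
  refine ⟨v, ?_, hvfit, fun k => rfl⟩
  have hletter : v.letter = u.letter ∘ f := rfl
  have hacc : v.scan (l₁.length + n) (n + l₂.length) ∈ M.accepts := by
    have hu' : u.scan (n + r) (n + r) ∈ M.accepts := by
      rw [hM]
      exact ⟨u, hu, _, _, hfit, rfl⟩
    have heq : M.eval (v.scan (l₁.length + n) (n + l₂.length)) =
        M.eval (u.scan (n + r) (n + r)) := by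
      rw [scan_eq, scan_eq, hletter, ← List.map_map, ← List.map_map, hf₁, hf₂, hk₁, hk₂]
      have hassoc : ∀ (a b c : List ℤ), a.map u.letter ++ Sum.inr () :: (b ++ c).map u.letter =
          (a.map u.letter ++ Sum.inr () :: b.map u.letter) ++ c.map u.letter := by
        intro a b c
        simp
      rw [hassoc, hassoc]
      unfold DFA.eval
      rw [DFA.evalFrom_of_append, DFA.evalFrom_of_append (y := k₂.map u.letter), ← he₂]
      congr 1
      rw [List.map_append, List.map_append, List.append_assoc, List.append_assoc,
        DFA.evalFrom_of_append, he₁, ← DFA.evalFrom_of_append]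
    rw [DFA.mem_accepts] at hu' ⊢
    rwa [heq]
  rw [hM] at hacc
  obtain ⟨w, hw, m, m', hwfit, hscan⟩ := hacc
  rwa [eq_of_scan_eq hvfit hwfit hscan]

/-- Simultaneous pumping: two words of two regular sets can be shortened outside the window
`[-n, n)` by the same deletion of positions, until they fit into `[-n - c, n + c)`. -/
theorem exists_pumping {γ₁ γ₂ : Type*} {S₁ : Set (Word γ₁)} {S₂ : Set (Word γ₂)}
    (hS₁ : IsRegularSet S₁) (hS₂ : IsRegularSet S₂) :
    ∃ c : ℕ, ∀ (n : ℕ), ∀ u₁ ∈ S₁, ∀ u₂ ∈ S₂, ∃ f : ℤ → ℤ,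
      (∀ k, -(n : ℤ) ≤ k ∧ k < n → f k = k) ∧
      (∀ k, ¬ (-(n : ℤ) ≤ k ∧ k < n) → ¬ (-(n : ℤ) ≤ f k ∧ f k < n)) ∧
      ∃ v₁ ∈ S₁, ∃ v₂ ∈ S₂, v₁.Fits (n + c) (n + c) ∧ v₂.Fits (n + c) (n + c) ∧
        (∀ k, v₁.symb k = u₁.symb (f k)) ∧ (∀ k, v₂.symb k = u₂.symb (f k)) := by
  obtain ⟨σ₁, _, M₁, hM₁⟩ := hS₁
  obtain ⟨σ₂, _, M₂, hM₂⟩ := hS₂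
  refine ⟨Fintype.card (σ₁ × σ₂), fun n u₁ hu₁ u₂ hu₂ => ?_⟩
  obtain ⟨r₁, hr₁⟩ := u₁.exists_fits
  obtain ⟨r₂, hr₂⟩ := u₂.exists_fits
  set r := r₁ + r₂
  -- The input letters of `P` are the positions themselves, translated into the symbols of `u₁` and
  -- of `u₂`. A shortened input is thus a list of positions, the same for both words.
  set P := DFA.parallel M₁ M₂ u₁.letter u₂.letter with hP
  have hneg : negPositions (r + n) =
      ((List.range r).map fun i : ℕ => (i : ℤ) - ((r + n : ℕ) : ℤ)) ++ negPositions n := by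
    simp only [negPositions, List.range_add, List.map_append, List.map_map]
    congr 2
    funext i
    simp
  have hnonneg : nonnegPositions (n + r) =
      nonnegPositions n ++ (List.range r).map fun i : ℕ => ((n + i : ℕ) : ℤ) := by
    simp only [nonnegPositions, List.range_add, List.map_append, List.map_map]
    rfl
  set k₁ : List ℤ := (List.range r).map fun i : ℕ => (i : ℤ) - ((r + n : ℕ) : ℤ) with hk₁
  set k₂ : List ℤ := (List.range r).map fun i : ℕ => ((n + i : ℕ) : ℤ) with hk₂
  obtain ⟨l₁, hl₁, hc₁, he₁⟩ := P.exists_short (M₁.start, M₂.start) k₁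
  -- The right part is shortened from the states reached after the window; these are not affected by
  -- the shortening on the left.
  obtain ⟨l₂, hl₂, hc₂, he₂⟩ := P.exists_short
    (M₁.evalFrom M₁.start ((k₁ ++ negPositions n).map u₁.letter ++
        Sum.inr () :: (nonnegPositions n).map u₁.letter),
      M₂.evalFrom M₂.start ((k₁ ++ negPositions n).map u₂.letter ++
        Sum.inr () :: (nonnegPositions n).map u₂.letter)) k₂
  simp only [hP, DFA.evalFrom_parallel, Prod.mk.injEq] at he₁ he₂
  obtain ⟨f, hf₁, hf₂, hf₃, hf₄, hf₅⟩ := exists_position_map n r l₁ l₂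
    (by
      intro k hk
      have := hl₁ hk
      simp only [hk₁, List.mem_map, List.mem_range] at this
      omega)
    (by
      intro k hk
      have := hl₂ hk
      simp only [hk₂, List.mem_map, List.mem_range] at this
      omega)
  rw [add_comm r n] at hneg
  obtain ⟨v₁, hv₁, hw₁, hs₁⟩ := exists_mem_of_evalFrom_eq hM₁ hu₁
    (hr₁.mono (by omega) (by omega)) hneg hnonneg hf₃ hf₄ hf₅ he₁.1 he₂.1
  obtain ⟨v₂, hv₂, hw₂, hs₂⟩ := exists_mem_of_evalFrom_eq hM₂ hu₂
    (hr₂.mono (by omega) (by omega)) hneg hnonneg hf₃ hf₄ hf₅ he₁.2 he₂.2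
  exact ⟨f, hf₁, hf₂, v₁, hv₁, v₂, hv₂, hw₁.mono (by omega) (by omega),
    hw₂.mono (by omega) (by omega), hs₁, hs₂⟩

end AutomaticGrid

/-! ### Pumping of convolutions -/

namespace AutomaticGrid

/-- Inside the window nothing moves, and outside it `f` only meets blanks of `w`. Hence pumping
leaves words that fit the window unchanged. -/
theorem Word.Fits.eq_of_symb_eq {γ : Type*} {v w : Word γ} {n : ℕ} (hw : w.Fits n n) {f : ℤ → ℤ}
    (hf : ∀ k, -(n : ℤ) ≤ k ∧ k < n → f k = k)
    (hf' : ∀ k, ¬ (-(n : ℤ) ≤ k ∧ k < n) → ¬ (-(n : ℤ) ≤ f k ∧ f k < n))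
    (h : ∀ k, v.symb k = w.symb (f k)) : v = w := by
  ext1
  funext k
  rw [h]
  by_cases hk : -(n : ℤ) ≤ k ∧ k < n
  · rw [hf k hk]
  · rw [hw.symb_eq_none hk, hw.symb_eq_none (hf' k hk)]

/-- With `bind`, blank positions of the convolution need no separate case, so a deletion applied to
a convolution acts on each component. -/
theorem conv_symb_bind {γ : Type*} {h : ℕ} (w : Fin h → Word γ) (i : Fin h) (k : ℤ) :
    ((conv w).symb k).bind (fun a => a i) = (w i).symb k := by
  simp only [conv]
  split_ifs with hk
  · simp [hk i]
  · rfl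

theorem conv₂_symb_bind_fst {γ δ : Type*} (v : Word γ) (w : Word δ) (k : ℤ) :
    ((conv₂ v w).symb k).bind Prod.fst = v.symb k := by
  simp only [conv₂]
  split_ifs with hk
  · simp [hk.1]
  · rfl

theorem conv₂_symb_bind_snd {γ δ : Type*} (v : Word γ) (w : Word δ) (k : ℤ) :
    ((conv₂ v w).symb k).bind Prod.snd = w.symb k := by
  simp only [conv₂]
  split_ifs with hk
  · simp [hk.2]
  · rfl

theorem Word.Fits.of_bind {γ δ : Type*} {w : Word γ} {v : Word δ} {m n : ℕ} (hw : w.Fits m n)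
    {g : γ → Option δ} (h : ∀ k, (w.symb k).bind g = v.symb k) : v.Fits m n := by
  intro k hk
  refine hw k fun h0 => hk ?_
  rw [← h, h0, Option.bind_none]

/-- In an automatic ternary relation, the third component can be chosen only a bounded amount
larger than the first two. -/
theorem IsAutomaticRel.exists_fits {γ : Type*} {R : Set (Fin 3 → Word γ)}
    (hR : IsAutomaticRel R) :
    ∃ c : ℕ, ∀ n : ℕ, ∀ x ∈ R, (x 0).Fits n n → (x 1).Fits n n →
      ∃ y ∈ R, y 0 = x 0 ∧ y 1 = x 1 ∧ (y 2).Fits (n + c) (n + c) := by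
  obtain ⟨c, hc⟩ := exists_pumping hR hR
  refine ⟨c, fun n x hx h0 h1 => ?_⟩
  obtain ⟨f, hf, hf', _, ⟨y, hy, rfl⟩, _, -, hfit, -, hs, -⟩ :=
    hc n (conv x) ⟨x, hx, rfl⟩ (conv x) ⟨x, hx, rfl⟩
  have hsymb : ∀ i k, (y i).symb k = (x i).symb (f k) := by
    intro i k
    rw [← conv_symb_bind, hs, conv_symb_bind]
  exact ⟨y, hy, h0.eq_of_symb_eq hf hf' (hsymb 0), h1.eq_of_symb_eq hf hf' (hsymb 1),
    hfit.of_bind (conv_symb_bind y 2)⟩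

/-! ### Sizes of grid elements: growth against counting -/

namespace SemiautomaticGrid

variable {α : Type*} (𝒢 : SemiautomaticGrid α)

/-- The grid elements that have a representative with domain in `[-n, n)`. -/
def short (n : ℕ) : Set ℝ := {r | ∃ w ∈ 𝒢.A, w.Fits n n ∧ 𝒢.val w = r}

theorem short_mono {m n : ℕ} (h : m ≤ n) : 𝒢.short m ⊆ 𝒢.short n := by
  rintro r ⟨w, hw, hfit, rfl⟩
  exact ⟨w, hw, hfit.mono h h, rfl⟩

theorem exists_word {r : ℝ} (hr : r ∈ 𝒢.G) : ∃ w ∈ 𝒢.A, 𝒢.val w = r := by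
  have : r ∈ 𝒢.val '' 𝒢.A := by
    rw [𝒢.image_val]
    exact hr
  exact this

theorem val_mem {w : Word α} (hw : w ∈ 𝒢.A) : 𝒢.val w ∈ 𝒢.G := by
  have : 𝒢.val w ∈ (𝒢.G : Set ℝ) := by
    rw [← 𝒢.image_val]
    exact ⟨w, hw, rfl⟩
  exact this

theorem exists_mem_short {r : ℝ} (hr : r ∈ 𝒢.G) : ∃ n, r ∈ 𝒢.short n := by
  obtain ⟨w, hw, rfl⟩ := 𝒢.exists_word hr
  obtain ⟨n, hn⟩ := w.exists_fits
  exact ⟨n, w, hw, hn, rfl⟩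

/-- Let the relation `x ∘ y = z` on `G` be automatic. Then the size of `x ∘ y` exceeds the sizes
of `x` and `y` only by a constant. -/
theorem exists_op_mem_short {op : ℝ → ℝ → ℝ} (hop : ∀ x ∈ 𝒢.G, ∀ y ∈ 𝒢.G, op x y ∈ 𝒢.G)
    (haut : IsAutomaticRel {x : Fin 3 → Word α |
      (∀ i, x i ∈ 𝒢.A) ∧ op (𝒢.val (x 0)) (𝒢.val (x 1)) = 𝒢.val (x 2)}) :
    ∃ c, ∀ n, ∀ x ∈ 𝒢.short n, ∀ y ∈ 𝒢.short n, op x y ∈ 𝒢.short (n + c) := by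
  obtain ⟨c, hc⟩ := haut.exists_fits
  refine ⟨c, ?_⟩
  rintro n _ ⟨u, hu, hun, rfl⟩ _ ⟨v, hv, hvn, rfl⟩
  obtain ⟨w, hw, hwval⟩ := 𝒢.exists_word (hop _ (𝒢.val_mem hu) _ (𝒢.val_mem hv))
  obtain ⟨y, ⟨hyA, hy⟩, h0, h1, h2⟩ := hc n ![u, v, w]
    ⟨by intro i; fin_cases i <;> simpa, by simp [hwval]⟩ hun hvn
  refine ⟨y 2, hyA 2, h2, ?_⟩
  rw [← hy, h0, h1]
  rfl

theorem finite_ncard_short [Finite α] (n : ℕ) :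
    (𝒢.short n).Finite ∧ (𝒢.short n).ncard ≤ Nat.card (Option α) ^ (2 * n) := by
  set T : Set (Word α) := {w | w.Fits n n}
  let F : T → (Fin (2 * n) → Option α) := fun w i => w.1.symb ((i : ℕ) - (n : ℤ))
  have hF : Function.Injective F := by
    intro v w h
    ext1
    ext1
    funext k
    by_cases hk : -(n : ℤ) ≤ k ∧ k < n
    · have := congrFun h ⟨(k + n).toNat, by omega⟩
      have hk' : (((k + n).toNat : ℕ) : ℤ) - n = k := by omega
      simpa only [F, hk'] using this
    · rw [Word.Fits.symb_eq_none v.2 hk, Word.Fits.symb_eq_none w.2 hk]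
  have hfin : Finite T := Finite.of_injective F hF
  have hsub : 𝒢.short n ⊆ 𝒢.val '' T := by
    rintro r ⟨w, -, hfit, rfl⟩
    exact ⟨w, hfit, rfl⟩
  have hTfin : T.Finite := hfin
  refine ⟨(hTfin.image _).subset hsub, ?_⟩
  calc (𝒢.short n).ncard ≤ (𝒢.val '' T).ncard := Set.ncard_le_ncard hsub (hTfin.image _)
    _ ≤ T.ncard := Set.ncard_image_le hTfin
    _ = Nat.card T := rfl
    _ ≤ Nat.card (Fin (2 * n) → Option α) := Nat.card_le_card_of_injective F hF
    _ = Nat.card (Option α) ^ (2 * n) := by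
      rw [Nat.card_fun, Nat.card_eq_fintype_card (α := Fin (2 * n)), Fintype.card_fin]

/-- Each squaring of the bound costs one product and one sum, by division with remainder by `2 ^ 2 ^
i`: both quotient and remainder are within the previous bound. -/
theorem natCast_mem_short {c d n₀ : ℕ}
    (hadd : ∀ n ≥ n₀, ∀ x ∈ 𝒢.short n, ∀ y ∈ 𝒢.short n, x + y ∈ 𝒢.short (n + c))
    (hmul : ∀ n ≥ n₀, ∀ x ∈ 𝒢.short n, ∀ y ∈ 𝒢.short n, x * y ∈ 𝒢.short (n + d))
    (h₀ : ∀ N : ℕ, N ≤ 2 → (N : ℝ) ∈ 𝒢.short n₀) (i : ℕ) :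
    ∀ N : ℕ, N ≤ 2 ^ 2 ^ i → (N : ℝ) ∈ 𝒢.short (n₀ + i * (d + c)) := by
  induction i with
  | zero => simpa using h₀
  | succ i ih =>
    intro N hN
    set X := 2 ^ 2 ^ i with hX
    have hpos : 0 < X := by positivity
    have hsq : 2 ^ 2 ^ (i + 1) = X * X := by
      rw [hX, ← pow_add]
      congr 1
      ring
    have h1 : N / X ≤ X := by
      rw [hsq] at hN
      exact Nat.div_le_of_le_mul hN
    have h2 : N % X ≤ X := (Nat.mod_lt N hpos).le
    have h3 := hmul _ (by omega) _ (ih X le_rfl) _ (ih _ h1)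
    have h4 := hadd _ (by omega) _ h3 _ (𝒢.short_mono (Nat.le_add_right _ d) (ih _ h2))
    have h5 : (N : ℝ) = (X : ℝ) * ((N / X : ℕ) : ℝ) + ((N % X : ℕ) : ℝ) := by
      exact_mod_cast (Nat.div_add_mod N X).symm
    rw [h5]
    convert h4 using 2
    ring

/-- The size of products grows more than by a constant: otherwise all natural numbers up to
`2 ^ 2 ^ i` would have representatives of size `O(i)`. -/
theorem not_forall_mul_mem_short [Finite α] (d n₀ : ℕ) :
    ¬ ∀ n ≥ n₀, ∀ x ∈ 𝒢.short n, ∀ y ∈ 𝒢.short n, x * y ∈ 𝒢.short (n + d) := by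
  intro hmul
  obtain ⟨c, hc⟩ := 𝒢.exists_op_mem_short (fun x hx y hy => 𝒢.G.add_mem hx hy) 𝒢.automatic_add
  have hnat : ∀ N : ℕ, ∃ n, (N : ℝ) ∈ 𝒢.short n := fun N => 𝒢.exists_mem_short (natCast_mem 𝒢.G N)
  choose s hs using hnat
  set n₁ := n₀ + s 0 + s 1 + s 2 with hn₁
  have hsmall : ∀ N : ℕ, N ≤ 2 → (N : ℝ) ∈ 𝒢.short n₁ := by
    intro N hN
    refine 𝒢.short_mono ?_ (hs N)
    interval_cases N <;> omega
  have hmem := 𝒢.natCast_mem_short (n₀ := n₁) (fun n _ => hc n)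
    (fun n hn => hmul n (by omega)) hsmall
  set K := Nat.card (Option α) with hK
  have hbound : ∀ i, 2 ^ i ≤ K * (2 * (n₁ + i * (d + c))) := by
    intro i
    obtain ⟨hfin, hcard⟩ := 𝒢.finite_ncard_short (n₁ + i * (d + c))
    have hsub : (fun N : ℕ => (N : ℝ)) '' (Set.Iio (2 ^ 2 ^ i)) ⊆ 𝒢.short (n₁ + i * (d + c)) := by
      rintro _ ⟨N, hN, rfl⟩
      exact hmem i N (le_of_lt hN)
    have h1 := Set.ncard_le_ncard hsub hfin
    rw [Set.ncard_image_of_injective _ Nat.cast_injective] at h1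
    have h2 : (Set.Iio (2 ^ 2 ^ i) : Set ℕ).ncard = 2 ^ 2 ^ i := by
      rw [← Finset.coe_Iio, Set.ncard_coe_finset, Nat.card_Iio]
    -- The estimate `K ≤ 2 ^ K` makes both sides powers of two, so that the exponents can be
    -- compared.
    have h3 : 2 ^ 2 ^ i ≤ 2 ^ (K * (2 * (n₁ + i * (d + c)))) := by
      rw [pow_mul, ← h2]
      exact (h1.trans hcard).trans (Nat.pow_le_pow_left K.lt_two_pow_self.le _)
    exact (Nat.pow_le_pow_iff_right (by norm_num)).1 h3
  set a := 2 * K * n₁ with ha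
  set b := 2 * K * (d + c) with hb
  have hlin : ∀ i, 2 ^ i ≤ a + b * i := by
    intro i
    refine (hbound i).trans (le_of_eq ?_)
    rw [ha, hb]
    ring
  -- At `i = 4 * (a + b + 2)` the left side `2 ^ i` is `P ^ 4 ≥ 9 * (a + b + 3) ^ 2`, while the
  -- right side is only quadratic in `a` and `b`, with smaller coefficients.
  set P := 2 ^ (a + b + 2) with hP
  have h1 : P * P * (P * P) ≤ a + b * (4 * (a + b + 2)) := by
    refine le_trans (le_of_eq ?_) (hlin (4 * (a + b + 2)))
    rw [hP]
    ring
  have h2 : a + b + 3 ≤ P := Nat.lt_two_pow_self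
  have h3 : (a + b + 3) * (a + b + 3) ≤ P * P := Nat.mul_le_mul h2 h2
  have h4 : 3 * 3 ≤ P * P := Nat.mul_le_mul (by omega) (by omega)
  have h5 := Nat.mul_le_mul h4 h3
  nlinarith

theorem not_isAutomaticRel_mulRel [Finite α] : ¬ IsAutomaticRel 𝒢.mulRel := by
  intro h
  obtain ⟨d, hd⟩ := 𝒢.exists_op_mem_short (fun x hx y hy => 𝒢.G.mul_mem hx hy) h
  exact 𝒢.not_forall_mul_mem_short d 0 fun n _ => hd n

/-! ### Lines that compute products -/

/-- The points of the straight line through `(0, 0)` and `(1, x)`. -/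
theorem snd_eq_mul_fst_of_mem_line {p q : ℝ × ℝ} {x : ℝ}
    (h₀ : ((0 : ℝ), (0 : ℝ)) ∈ affineSpan ℝ {p, q}) (h₁ : ((1 : ℝ), x) ∈ affineSpan ℝ {p, q})
    {z : ℝ × ℝ} (hz : z ∈ affineSpan ℝ {p, q}) : z.2 = x * z.1 := by
  rw [mem_affineSpan_pair_iff_exists_lineMap_eq] at h₀ h₁ hz
  obtain ⟨r, hr⟩ := h₀
  obtain ⟨s, hs⟩ := h₁
  obtain ⟨t, rfl⟩ := hz
  simp only [AffineMap.lineMap_apply, Prod.ext_iff, vsub_eq_sub, vadd_eq_add, Prod.smul_fst,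
    Prod.smul_snd, Prod.fst_add, Prod.snd_add, Prod.fst_sub, Prod.snd_sub, smul_eq_mul]
    at hr hs ⊢
  obtain ⟨r1, r2⟩ := hr
  obtain ⟨s1, s2⟩ := hs
  -- The difference of the two given points is `(1, x)`, a multiple of the direction `q - p`.
  have e1 : (s - r) * (q.1 - p.1) = 1 := by linear_combination s1 - r1
  have e2 : (s - r) * (q.2 - p.2) = x := by linear_combination s2 - r2
  linear_combination r2 - x * r1 - (t - r) * (q.2 - p.2) * e1 + (t - r) * (q.1 - p.1) * e2

theorem mem_line_of_snd_eq_mul_fst {p q : ℝ × ℝ} {x : ℝ}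
    (h₀ : ((0 : ℝ), (0 : ℝ)) ∈ affineSpan ℝ {p, q}) (h₁ : ((1 : ℝ), x) ∈ affineSpan ℝ {p, q})
    (y : ℝ) : (y, x * y) ∈ affineSpan ℝ {p, q} := by
  have := AffineMap.lineMap_mem y h₀ h₁
  simpa [AffineMap.lineMap_apply, mul_comm] using this

theorem slopeLines_subset_lines : 𝒢.slopeLines ⊆ 𝒢.lines := by
  rintro _ ⟨m, hm, c, hc, rfl⟩
  refine ⟨(0, c), ⟨𝒢.G.zero_mem, hc⟩, (1, m + c), ⟨𝒢.G.one_mem, 𝒢.G.add_mem hm hc⟩, by simp, ?_⟩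
  ext ⟨x, y⟩
  simp only [Set.mem_ofPred_eq, Set.mem_inter_iff, SetLike.mem_coe,
    mem_affineSpan_pair_iff_exists_lineMap_eq, AffineMap.lineMap_apply, Prod.ext_iff, vsub_eq_sub,
    vadd_eq_add, Prod.smul_fst, Prod.smul_snd, Prod.fst_add, Prod.snd_add, Prod.fst_sub,
    Prod.snd_sub, smul_eq_mul]
  refine and_congr_right fun _ => ⟨fun h => ⟨x, by ring, by rw [h]; ring⟩, ?_⟩
  rintro ⟨r, h1, h2⟩
  linear_combination m * h1 - h2

theorem lines_subset_realLines : 𝒢.lines ⊆ 𝒢.realLines := by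
  rintro L ⟨p, -, q, -, h⟩
  exact ⟨p, q, h⟩

/-- An automatic family of lines that contains all lines with slope and intercept in `G` makes
products short. -/
theorem exists_mul_mem_short_of_lines {𝓛 : Set (Set (ℝ × ℝ))} (h₁ : 𝒢.slopeLines ⊆ 𝓛)
    (h₂ : 𝓛 ⊆ 𝒢.realLines) (h : 𝒢.FormsAutomaticFamily 𝓛) :
    ∃ d n₀, ∀ n ≥ n₀, ∀ x ∈ 𝒢.short n, ∀ y ∈ 𝒢.short n, x * y ∈ 𝒢.short (n + d) := by
  obtain ⟨δ, -, E, L, hL, -, hreg⟩ := h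
  obtain ⟨c, hc⟩ := exists_pumping hreg hreg
  obtain ⟨w₀, hw₀A, hw₀⟩ := 𝒢.exists_word 𝒢.G.zero_mem
  obtain ⟨w₁, hw₁A, hw₁⟩ := 𝒢.exists_word 𝒢.G.one_mem
  obtain ⟨m₀, hm₀⟩ := w₀.exists_fits
  obtain ⟨m₁, hm₁⟩ := w₁.exists_fits
  -- Two pumpings cost `c` each; the threshold makes the chosen representatives of `0` and `1` fit
  -- the window.
  refine ⟨c + c, m₀ + m₁, ?_⟩
  rintro n hn _ ⟨u, hu, hun, rfl⟩ _ ⟨v, hv, hvn, rfl⟩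
  set x := 𝒢.val u
  set y := 𝒢.val v
  have hxG : x ∈ 𝒢.G := 𝒢.val_mem hu
  have hyG : y ∈ 𝒢.G := 𝒢.val_mem hv
  obtain ⟨e, heE, he⟩ : {p | p ∈ 𝒢.plane ∧ p.2 = x * p.1 + 0} ∈ L '' E := by
    rw [hL]
    exact h₁ ⟨x, hxG, 0, 𝒢.G.zero_mem, rfl⟩
  have hsplit : ∀ {a b : Word (Option δ × Option (Option α × Option α))} {f : ℤ → ℤ},
      (∀ k, a.symb k = b.symb (f k)) → ∀ {d d' : Word δ} {s s' t t' : Word α},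
      a = conv₂ d (conv₂ s t) → b = conv₂ d' (conv₂ s' t') →
      (∀ k, d.symb k = d'.symb (f k)) ∧ (∀ k, s.symb k = s'.symb (f k)) ∧
        (∀ k, t.symb k = t'.symb (f k)) := by
    rintro _ _ f hab d d' s s' t t' rfl rfl
    refine ⟨fun k => ?_, fun k => ?_, fun k => ?_⟩
    · rw [← conv₂_symb_bind_fst d (conv₂ s t), hab, conv₂_symb_bind_fst]
    · rw [← conv₂_symb_bind_fst s t, ← conv₂_symb_bind_snd d (conv₂ s t), hab,
        conv₂_symb_bind_snd, conv₂_symb_bind_fst]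
    · rw [← conv₂_symb_bind_snd s t, ← conv₂_symb_bind_snd d (conv₂ s t), hab,
        conv₂_symb_bind_snd, conv₂_symb_bind_snd]
  obtain ⟨f, hf, hf', a₁, ⟨e₁, he₁E, _, ⟨s₁, -, t₁, -, hp₁, rfl⟩, rfl⟩,
      a₂, ⟨e₂, he₂E, _, ⟨s₂, -, t₂, -, hp₂, rfl⟩, rfl⟩, hfit, -, hs, hs'⟩ :=
    hc n (conv₂ e (conv₂ w₀ w₀))
      ⟨e, heE, _, ⟨w₀, hw₀A, w₀, hw₀A, by
        rw [he, hw₀]; exact ⟨⟨𝒢.G.zero_mem, 𝒢.G.zero_mem⟩, by simp⟩, rfl⟩, rfl⟩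
      (conv₂ e (conv₂ w₁ u))
      ⟨e, heE, _, ⟨w₁, hw₁A, u, hu, by
        rw [he, hw₁]; exact ⟨⟨𝒢.G.one_mem, hxG⟩, by simp [x]⟩, rfl⟩, rfl⟩
  obtain ⟨g₁, g₂, g₃⟩ := hsplit hs rfl rfl
  obtain ⟨g₁', g₂', g₃'⟩ := hsplit hs' rfl rfl
  have hfit₀ : w₀.Fits n n := hm₀.mono (by omega) (by omega)
  have hfit₁ : w₁.Fits n n := hm₁.mono (by omega) (by omega)
  -- Both are images of `e` under the same `f`; separate pumpings could yield indices of different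
  -- lines.
  obtain rfl : e₂ = e₁ := by
    ext1
    funext k
    rw [g₁, g₁']
  rw [hfit₀.eq_of_symb_eq hf hf' g₂, hfit₀.eq_of_symb_eq hf hf' g₃, hw₀] at hp₁
  rw [hfit₁.eq_of_symb_eq hf hf' g₂', hun.eq_of_symb_eq hf hf' g₃', hw₁] at hp₂
  have he₂fit : e₂.Fits (n + c) (n + c) := hfit.of_bind (conv₂_symb_bind_fst _ _)
  obtain ⟨p, q, -, hline⟩ : L e₂ ∈ 𝒢.realLines := h₂ (hL ▸ ⟨e₂, he₂E, rfl⟩)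
  rw [hline] at hp₁ hp₂
  obtain ⟨w, hw, hwval⟩ := 𝒢.exists_word (𝒢.G.mul_mem hxG hyG)
  -- Now the window is `[-(n + c), n + c)`, which contains the index `e₂`. Only the first word
  -- matters; the second is an arbitrary member of the regular set.
  obtain ⟨f₁, hf₁, hf₁', _, ⟨e₃, he₃E, _, ⟨s₃, -, t₃, ht₃, hp₃, rfl⟩, rfl⟩,
      _, -, hfit', -, hs₃, -⟩ :=
    hc (n + c) (conv₂ e₂ (conv₂ v w))
      ⟨e₂, he₂E, _, ⟨v, hv, w, hw, by
        rw [hline, hwval]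
        exact ⟨⟨hyG, 𝒢.G.mul_mem hxG hyG⟩, mem_line_of_snd_eq_mul_fst hp₁.2 hp₂.2 y⟩, rfl⟩, rfl⟩
      (conv₂ e₂ (conv₂ w₁ u)) ⟨e₂, he₂E, _, ⟨w₁, hw₁A, u, hu, by
        rw [hline, hw₁]; exact hp₂, rfl⟩, rfl⟩
  obtain ⟨k₁, k₂, -⟩ := hsplit hs₃ rfl rfl
  rw [he₂fit.eq_of_symb_eq hf₁ hf₁' k₁,
    (hvn.mono (Nat.le_add_right n c) (Nat.le_add_right n c)).eq_of_symb_eq hf₁ hf₁' k₂,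
    hline] at hp₃
  refine ⟨t₃, ht₃, ?_, snd_eq_mul_fst_of_mem_line hp₁.2 hp₂.2 hp₃.2⟩
  rw [← add_assoc]
  exact (hfit'.of_bind (conv₂_symb_bind_snd _ _)).of_bind (conv₂_symb_bind_snd _ _)

theorem not_formsAutomaticFamily [Finite α] {𝓛 : Set (Set (ℝ × ℝ))} (h₁ : 𝒢.slopeLines ⊆ 𝓛)
    (h₂ : 𝓛 ⊆ 𝒢.realLines) : ¬ 𝒢.FormsAutomaticFamily 𝓛 := by
  intro h
  obtain ⟨d, n₀, hd⟩ := 𝒢.exists_mul_mem_short_of_lines h₁ h₂ h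
  exact 𝒢.not_forall_mul_mem_short d n₀ hd

end SemiautomaticGrid

end AutomaticGrid

theorem mainTheorem10 {α : Type*} [Finite α] (𝒢 : AutomaticGrid.SemiautomaticGrid α) :
    ¬ 𝒢.FormsAutomaticFamily 𝒢.lines ∧
    (∀ 𝓛 : Set (Set (ℝ × ℝ)), 𝒢.slopeLines ⊆ 𝓛 → 𝓛 ⊆ 𝒢.realLines →
      ¬ 𝒢.FormsAutomaticFamily 𝓛) ∧
    ¬ AutomaticGrid.IsAutomaticRel 𝒢.mulRel := by
  exact ⟨𝒢.not_formsAutomaticFamily 𝒢.slopeLines_subset_lines 𝒢.lines_subset_realLines,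
    fun _ h₁ h₂ => 𝒢.not_formsAutomaticFamily h₁ h₂, 𝒢.not_isAutomaticRel_mulRel⟩
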